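/- \textbf{Theorem (Deficiency gap for proxy-based reductions).} Let $\mathcal X,\mathcal Y$ be standard Borel spaces, $\Theta\neq\emptyset$, and let $\mathcal E=\{P_\theta:\theta\in\Theta\}$ be an experiment for $(X,Y)$, i.e. a family of probability measures on $\mathcal X\times\mathcal Y$, dominated by a $\sigma$-finite measure. Let $U$ be auxiliary randomness whose conditional law given $(X,Y)$ is a Markov kernel not depending on $\theta$ (for instance $U$ independent of $(X,Y)$ with a known law), let $T=T(X,U)$ be a measurable proxy statistic (for instance $T=\widehat m(X)$ for a learned predictor $\widehat m$), and let $C=C(X,Y,U)$ be a measurable statistic, the labeled correction. For $S=T$ or $S=(T,C)$, let $\mathcal E_S=\{P^S_\theta:\theta\in\Theta\}$ be the experiment of observing $S$, where $P^S_\theta$ is the law of $S$ when $(X,Y)\sim P_\theta$. $S$ is called \emph{Blackwell-sufficient} if there is a Markov kernel $K$, not depending on $\theta$, from the space of $S$ to $\mathcal X\times\mathcal Y$ such that $\int K(s,\cdot)\,P^S_\theta(ds)=P_\theta$ for all $\theta$. A decision problem consists of a finite action set $A$ and losses $L_\theta:A\to[0,1]$, $\theta\in\Theta$; a decision rule for an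 experiment is a Markov kernel $\rho$ from its sample space to $A$, with risk $R_\theta(\rho)=\int\sum_{a} L_\theta(a)\,\rho(\{a\}\mid x)\,dP_\theta(x)$ (and with $P^S_\theta$ in place of $P_\theta$ for rules based on $S$). The \emph{deficiency} $\delta(\mathcal E_S,\mathcal E)$ is the infimum of all $\varepsilon\ge 0$ such that for every decision problem and every rule $\rho$ for $\mathcal E$ there is a rule $\sigma$ for $\mathcal E_S$ with $R_\theta(\sigma)-R_\theta(\rho)\le\varepsilon$ for all $\theta$. (1) If $T$ is not Blackwell-sufficient, then $\delta(\mathcal E_T,\mathcal E)>0$, and there is a decision problem on which the rules based on $T$ are uniformly dominated, in the sense below, by rules based on the full labeled data $(X,Y)$. (2) If the proxy together with its labeled correction, $S=(T,C)$, is not Blackwell-sufficient, then $\delta(\mathcal E_S,\mathcal E)>0$, and there is a decision problem on which the rules based on $(T,C)$ are uniformly dominated, in the same sense, by rules based on the full labeled data. Here \emph{uniformly dominated} means the following, for $S=T$ or $S=(T,C)$. (a) For every rule $\sigma$ based on $S$ there is a full-data rule $\rho'$ with $R_\theta(\rho')\le R_\theta(\sigma)$ for all $\theta$. (b) There are a single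 full-data rule $\rho$ and a $\gamma>0$ such that $\sup_\theta R_\theta(\rho)+\gamma\le\sup_\theta R_\theta(\sigma)$ for every rule $\sigma$ based on $S$. (c) For this $\rho$ there is a rule $\sigma_0$ based on $S$, minimax among all rules based on $S$, such that $R_\theta(\rho)\le R_\theta(\sigma_0)$ for all $\theta$, with strict inequality for some $\theta$. -/

import Mathlib

open MeasureTheory ProbabilityTheory

namespace StatExp

noncomputable section

/-- The experiment `(P θ)` on `𝓩` is dominated: all its laws are absolutely continuous with
respect to one σ-finite measure. -/
def IsDominated {Θ 𝓩 : Type*} [MeasurableSpace 𝓩] (P : Θ → Measure 𝓩) : Prop :=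
  ∃ μ : Measure 𝓩, SigmaFinite μ ∧ ∀ θ, P θ ≪ μ

/-- The experiment `Q` on `𝓣` is Blackwell-sufficient for the experiment `P` on `𝓩`: one Markov
kernel from `𝓣` to `𝓩`, the same for every parameter, reproduces each `P θ` from `Q θ`. -/
def BlackwellSufficient {Θ 𝓣 𝓩 : Type*} [MeasurableSpace 𝓣] [MeasurableSpace 𝓩]
    (Q : Θ → Measure 𝓣) (P : Θ → Measure 𝓩) : Prop :=
  ∃ K : Kernel 𝓣 𝓩, IsMarkovKernel K ∧ ∀ θ, K ∘ₘ (Q θ) = P θ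

/-- Losses with values in `[0, 1]` on the finite action set `Fin k`, one for each parameter. -/
def IsUnitLoss {Θ : Type*} {k : ℕ} (L : Θ → Fin k → ℝ) : Prop :=
  ∀ θ a, L θ a ∈ Set.Icc (0 : ℝ) 1

/-- The risk at `θ` of the randomized decision rule `ρ` (a Markov kernel from the sample space to
the actions) under the loss `L`. -/
def risk {Θ 𝓩 : Type*} [MeasurableSpace 𝓩] {k : ℕ} (P : Θ → Measure 𝓩) (L : Θ → Fin k → ℝ)
    (ρ : Kernel 𝓩 (Fin k)) (θ : Θ) : ℝ :=
  ∫ x, ∫ a, L θ a ∂(ρ x) ∂(P θ)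

/-- The worst-case risk of a decision rule. -/
def worstRisk {Θ 𝓩 : Type*} [MeasurableSpace 𝓩] {k : ℕ} (P : Θ → Measure 𝓩) (L : Θ → Fin k → ℝ)
    (ρ : Kernel 𝓩 (Fin k)) : ℝ :=
  ⨆ θ, risk P L ρ θ

/-- Le Cam's deficiency `δ(Q, P)`: the infimum of the `ε ≥ 0` such that, for every finite action
set, every `[0, 1]`-valued loss family and every decision rule `ρ` for `P`, some decision rule `σ`
for `Q` has risk at most that of `ρ` plus `ε` at every parameter. -/
def deficiency {Θ 𝓣 𝓩 : Type*} [MeasurableSpace 𝓣] [MeasurableSpace 𝓩]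
    (Q : Θ → Measure 𝓣) (P : Θ → Measure 𝓩) : ℝ :=
  sInf {ε : ℝ | 0 ≤ ε ∧ ∀ (k : ℕ) (L : Θ → Fin k → ℝ), IsUnitLoss L →
    ∀ ρ : Kernel 𝓩 (Fin k), IsMarkovKernel ρ →
      ∃ σ : Kernel 𝓣 (Fin k), IsMarkovKernel σ ∧ ∀ θ, risk Q L σ θ - risk P L ρ θ ≤ ε}

/-- The decision problem `L` on which the rules based on `Q` are uniformly dominated by rules
based on `P`:
* the risk function of every rule for `Q` is matched or improved, at every parameter, by a rule
  for `P`;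
* one rule `ρ` for `P` beats all rules for `Q` in worst-case risk, by a common margin `γ > 0`;
* this `ρ` dominates, parameter by parameter, a rule for `Q` that is minimax among the rules
  for `Q`. -/
def UniformlyDominatedOn {Θ 𝓣 𝓩 : Type*} [MeasurableSpace 𝓣] [MeasurableSpace 𝓩] {k : ℕ}
    (Q : Θ → Measure 𝓣) (P : Θ → Measure 𝓩) (L : Θ → Fin k → ℝ) : Prop :=
  (∀ σ : Kernel 𝓣 (Fin k), IsMarkovKernel σ →
    ∃ ρ : Kernel 𝓩 (Fin k), IsMarkovKernel ρ ∧ ∀ θ, risk P L ρ θ ≤ risk Q L σ θ) ∧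
  ∃ ρ : Kernel 𝓩 (Fin k), IsMarkovKernel ρ ∧
    (∃ γ : ℝ, 0 < γ ∧ ∀ σ : Kernel 𝓣 (Fin k), IsMarkovKernel σ →
      worstRisk P L ρ + γ ≤ worstRisk Q L σ) ∧
    ∃ σ₀ : Kernel 𝓣 (Fin k), IsMarkovKernel σ₀ ∧
      (∀ σ : Kernel 𝓣 (Fin k), IsMarkovKernel σ → worstRisk Q L σ₀ ≤ worstRisk Q L σ) ∧
      (∀ θ, risk P L ρ θ ≤ risk Q L σ₀ θ) ∧ ∃ θ, risk P L ρ θ < risk Q L σ₀ θ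

/-- The experiment of observing `T (X, U)`, where `(X, Y)` has law `P θ` and the auxiliary
randomness `U` has conditional law `κ (x, y)`, free of `θ`, given `(X, Y) = (x, y)`. (A constant
kernel `κ` is the case of `U` independent of the data.) -/
def proxyExperiment {Θ 𝓧 𝓨 𝓤 𝓣 : Type*} [MeasurableSpace 𝓧] [MeasurableSpace 𝓨]
    [MeasurableSpace 𝓤] [MeasurableSpace 𝓣] (P : Θ → Measure (𝓧 × 𝓨))
    (κ : Kernel (𝓧 × 𝓨) 𝓤) (T : 𝓧 × 𝓤 → 𝓣) : Θ → Measure 𝓣 :=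
  fun θ => ((P θ) ⊗ₘ κ).map (fun z => T (z.1.1, z.2))

/-- The experiment of observing the proxy `T (X, U)` together with a labeled correction
`C ((X, Y), U)`. -/
def correctedExperiment {Θ 𝓧 𝓨 𝓤 𝓣 𝓒 : Type*} [MeasurableSpace 𝓧] [MeasurableSpace 𝓨]
    [MeasurableSpace 𝓤] [MeasurableSpace 𝓣] [MeasurableSpace 𝓒] (P : Θ → Measure (𝓧 × 𝓨))
    (κ : Kernel (𝓧 × 𝓨) 𝓤) (T : 𝓧 × 𝓤 → 𝓣) (C : (𝓧 × 𝓨) × 𝓤 → 𝓒) : Θ → Measure (𝓣 × 𝓒) :=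
  fun θ => ((P θ) ⊗ₘ κ).map (fun z => (T (z.1.1, z.2), C z))

end

end StatExp

/-! Given the data, the statistic S is drawn from a kernel M free of θ, so its experiment is a
garbling M ∘ P (`map_compProd_eq_comp`). Everything rests on a randomization criterion
(`blackwellSufficient_of_not_separated`): if no finite decision problem separates the rules based on
S from a full-data rule by a positive margin, then S is Blackwell-sufficient.

To prove the criterion, embed the data space in ℝ and quantize it by finitely many rational
thresholds. Reporting the cell is a rule with finitely many actions; by Hahn-Banach
(`exists_actionProb_near`), rules based on S match its action probabilities up to ε on any finite
set of parameters. An ultrafilter limit of these rules exists by weak-* compactness, which uses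
domination, and yields a rational distribution function depending on S.
`blackwellSufficient_of_ratCDF` turns it into the required kernel.

Hence failure of sufficiency gives a loss, a full-data rule ρ and a margin γ > 0, and the deficiency
is at least γ. For uniform domination, `exists_uniformlyDominatedOn` modifies this loss so that both
ρ and a minimax rule based on S have constant risk. -/

namespace StatExp

open Filter Topology

/-! ### Weak-* compactness of [0, 1]-valued functions. -/

section WeakLimit

variable {ι 𝓣 : Type*} [MeasurableSpace 𝓣]

theorem integrable_of_mem_Icc (ν : Measure 𝓣) [IsFiniteMeasure ν] {f : 𝓣 → ℝ}
    (hf : Measurable f) (h0 : ∀ t, 0 ≤ f t) (h1 : ∀ t, f t ≤ 1) : Integrable f ν :=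
  Integrable.of_bound hf.aestronglyMeasurable 1
    (ae_of_all _ fun t => by rw [Real.norm_eq_abs, abs_of_nonneg (h0 t)]; exact h1 t)

theorem integrable_mul_of_mem_Icc {ν : Measure 𝓣} {f h : 𝓣 → ℝ}
    (hf : Measurable f) (h0 : ∀ t, 0 ≤ f t) (h1 : ∀ t, f t ≤ 1) (hh : Integrable h ν) :
    Integrable (fun t => h t * f t) ν :=
  hh.mul_bdd (c := 1) hf.aestronglyMeasurable
    (ae_of_all _ fun t => by rw [Real.norm_eq_abs, abs_of_nonneg (h0 t)]; exact h1 t)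

/-- The integral against a fixed `[0, 1]`-valued function is 1-Lipschitz on `L¹`. -/
theorem dist_integral_mul_le {ν : Measure 𝓣} {f : 𝓣 → ℝ}
    (hf : Measurable f) (h0 : ∀ t, 0 ≤ f t) (h1 : ∀ t, f t ≤ 1) (u v : Lp ℝ 1 ν) :
    dist (∫ t, u t * f t ∂ν) (∫ t, v t * f t ∂ν) ≤ dist u v := by
  have hu := integrable_mul_of_mem_Icc hf h0 h1 (L1.integrable_coeFn u)
  have hv := integrable_mul_of_mem_Icc hf h0 h1 (L1.integrable_coeFn v)
  rw [dist_eq_norm, ← integral_sub hu hv, L1.dist_eq_integral_dist]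
  refine norm_integral_le_of_norm_le ?_ (ae_of_all _ fun t => ?_)
  · simp_rw [dist_eq_norm]
    exact ((L1.integrable_coeFn u).sub (L1.integrable_coeFn v)).norm
  · rw [← sub_mul, norm_mul, dist_eq_norm]
    refine mul_le_of_le_one_right (norm_nonneg _) ?_
    rw [Real.norm_eq_abs, abs_of_nonneg (h0 t)]; exact h1 t

/-- Set integrals of `[0, 1]`-valued functions converge, along an ultrafilter, to the set
integrals of a `[0, 1]`-valued function. -/
theorem exists_tendsto_setIntegral (ν : Measure 𝓣) [IsFiniteMeasure ν] (U : Ultrafilter ι)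
    (f : ι → 𝓣 → ℝ) (hf : ∀ i, Measurable (f i)) (h0 : ∀ i t, 0 ≤ f i t)
    (h1 : ∀ i t, f i t ≤ 1) :
    ∃ g : 𝓣 → ℝ, Measurable g ∧ (∀ t, 0 ≤ g t) ∧ (∀ t, g t ≤ 1) ∧
      ∀ s, MeasurableSet s →
        Tendsto (fun i => ∫ t in s, f i t ∂ν) U (𝓝 (∫ t in s, g t ∂ν)) := by
  have hbd : ∀ i, ∀ᵐ t ∂ν, ‖f i t‖ ≤ 1 := fun i => ae_of_all _ fun t => by
    rw [Real.norm_eq_abs, abs_of_nonneg (h0 i t)]; exact h1 i t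
  have hmem : ∀ i, MemLp (f i) 2 ν := fun i =>
    MemLp.of_bound (hf i).aestronglyMeasurable 1 (hbd i)
  -- Banach-Alaoglu applies to a bounded family of functionals on L², and Riesz representation turns
  -- the limit functional back into a function. Indicators are in L² because ν is finite.
  let F : ι → WeakDual ℝ (Lp ℝ 2 ν) := fun i =>
    StrongDual.toWeakDual (InnerProductSpace.toDual ℝ (Lp ℝ 2 ν) (hmem i).toLp)
  obtain ⟨R, hR⟩ : ∃ R : ℝ, ∀ i, ‖(hmem i).toLp‖ ≤ R := by
    refine ⟨_, fun i => Lp.norm_le_of_ae_bound (C := 1) zero_le_one ?_⟩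
    filter_upwards [(hmem i).coeFn_toLp, hbd i] with t ht hb
    rw [ht]; exact hb
  have hK := WeakDual.isCompact_closedBall (𝕜 := ℝ) (E := Lp ℝ 2 ν) 0 R
  obtain ⟨ψ, -, hψ⟩ := hK.ultrafilter_le_nhds (U.map F) (by
    refine le_principal_iff.2 (Filter.mem_map.2 (Filter.univ_mem' fun i => ?_))
    simp only [Set.mem_preimage, mem_closedBall_zero_iff]
    change ‖InnerProductSpace.toDual ℝ (Lp ℝ 2 ν) (hmem i).toLp‖ ≤ R
    rw [LinearIsometryEquiv.norm_map]; exact hR i)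
  have hlim : Tendsto F U (𝓝 ψ) := hψ
  let G : Lp ℝ 2 ν := (InnerProductSpace.toDual ℝ (Lp ℝ 2 ν)).symm (WeakDual.toStrongDual ψ)
  have hset : ∀ s, MeasurableSet s →
      Tendsto (fun i => ∫ t in s, f i t ∂ν) U (𝓝 (∫ t in s, G t ∂ν)) := by
    intro s hs
    have h := ((WeakDual.eval_continuous
      (indicatorConstLp 2 hs (measure_ne_top ν s) (1 : ℝ))).tendsto ψ).comp hlim
    convert h using 2
    · rename_i i
      change _ = (InnerProductSpace.toDual ℝ (Lp ℝ 2 ν) (hmem i).toLp) _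
      rw [InnerProductSpace.toDual_apply_apply, real_inner_comm,
        L2.inner_indicatorConstLp_one]
      exact setIntegral_congr_ae hs ((hmem i).coeFn_toLp.mono fun t ht _ => ht.symm)
    · rw [← L2.inner_indicatorConstLp_one (𝕜 := ℝ) hs (measure_ne_top ν s), real_inner_comm]
      exact InnerProductSpace.toDual_symm_apply
  have hGi : Integrable G ν := (Lp.memLp G).integrable one_le_two
  have hfi : ∀ i, Integrable (f i) ν := fun i => integrable_of_mem_Icc ν (hf i) (h0 i) (h1 i)
  have hG0 : ∀ᵐ t ∂ν, 0 ≤ G t :=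
    ae_le_of_forall_setIntegral_le (integrable_zero _ _ _) hGi fun s hs _ => by
      simpa using ge_of_tendsto' (hset s hs) fun i => integral_nonneg (h0 i)
  have hG1 : ∀ᵐ t ∂ν, G t ≤ 1 :=
    ae_le_of_forall_setIntegral_le hGi (integrable_const _) fun s hs _ =>
      le_of_tendsto' (hset s hs) fun i =>
        setIntegral_mono (hfi i).integrableOn (integrable_const _) (h1 i)
  -- The bounds on G hold only almost everywhere; clipping a measurable version makes them hold
  -- everywhere.
  let g₀ := (Lp.aestronglyMeasurable G).mk G
  have hg₀ : Measurable g₀ := (Lp.aestronglyMeasurable G).stronglyMeasurable_mk.measurable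
  refine ⟨fun t => max 0 (min 1 (g₀ t)), measurable_const.max (measurable_const.min hg₀),
    fun t => le_max_left _ _, fun t => max_le zero_le_one (min_le_left _ _), fun s hs => ?_⟩
  have hae : (fun t => max 0 (min 1 (g₀ t))) =ᵐ[ν] G := by
    filter_upwards [hG0, hG1, (Lp.aestronglyMeasurable G).ae_eq_mk] with t h0 h1 h2
    change max 0 (min 1 ((Lp.aestronglyMeasurable G).mk G t)) = _
    rw [← h2, min_eq_right h1, max_eq_right h0]
  rw [setIntegral_congr_ae hs (hae.mono fun t ht _ => ht)]
  exact hset s hs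

/-- Weak-* compactness of the `[0, 1]`-valued functions: along an ultrafilter, the
integrals against every finite measure absolutely continuous with respect to `ν` converge to those
of one `[0, 1]`-valued function. -/
theorem exists_tendsto_integral (ν : Measure 𝓣) [IsFiniteMeasure ν] (U : Ultrafilter ι)
    (f : ι → 𝓣 → ℝ) (hf : ∀ i, Measurable (f i)) (h0 : ∀ i t, 0 ≤ f i t)
    (h1 : ∀ i t, f i t ≤ 1) :
    ∃ g : 𝓣 → ℝ, Measurable g ∧ (∀ t, 0 ≤ g t) ∧ (∀ t, g t ≤ 1) ∧
      ∀ m : Measure 𝓣, IsFiniteMeasure m → m ≪ ν →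
        Tendsto (fun i => ∫ t, f i t ∂m) U (𝓝 (∫ t, g t ∂m)) := by
  obtain ⟨g, hg, hg0, hg1, hset⟩ := exists_tendsto_setIntegral ν U f hf h0 h1
  refine ⟨g, hg, hg0, hg1, fun m hm hmν => ?_⟩
  -- From indicators to all of L¹: the functionals are 1-Lipschitz uniformly in i, so the set of
  -- good h is closed. The density of m is then one such h.
  have key : ∀ ⦃h : 𝓣 → ℝ⦄, Integrable h ν →
      Tendsto (fun i => ∫ t, h t * f i t ∂ν) U (𝓝 (∫ t, h t * g t ∂ν)) := by
    refine Integrable.induction (P := fun h =>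
      Tendsto (fun i => ∫ t, h t * f i t ∂ν) U (𝓝 (∫ t, h t * g t ∂ν))) ?_ ?_ ?_ ?_
    · intro c s hs _
      have hind : ∀ u : 𝓣 → ℝ,
          ∫ t, s.indicator (fun _ => c) t * u t ∂ν = c * ∫ t in s, u t ∂ν := by
        intro u
        rw [← integral_const_mul, ← integral_indicator hs]
        congr 1 with t
        by_cases ht : t ∈ s <;> simp [ht]
      simp_rw [hind]
      exact (hset s hs).const_mul c
    · intro u v _ hu hv htu htv
      have hadd : ∀ w : 𝓣 → ℝ, Measurable w → (∀ t, 0 ≤ w t) → (∀ t, w t ≤ 1) →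
          ∫ t, (u + v) t * w t ∂ν = ∫ t, u t * w t ∂ν + ∫ t, v t * w t ∂ν := by
        intro w hw w0 w1
        rw [← integral_add (integrable_mul_of_mem_Icc hw w0 w1 hu)
          (integrable_mul_of_mem_Icc hw w0 w1 hv)]
        simp [add_mul]
      rw [hadd g hg hg0 hg1]
      simp_rw [fun i => hadd (f i) (hf i) (h0 i) (h1 i)]
      exact htu.add htv
    · have hlip : ∀ w : 𝓣 → ℝ, Measurable w → (∀ t, 0 ≤ w t) → (∀ t, w t ≤ 1) →
          LipschitzWith 1 (fun u : Lp ℝ 1 ν => ∫ t, u t * w t ∂ν) := fun w hw w0 w1 =>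
        LipschitzWith.mk_one fun u v => dist_integral_mul_le hw w0 w1 u v
      exact Equicontinuous.isClosed_setOfPred_tendsto
        (LipschitzWith.uniformEquicontinuous _ 1
          fun i => hlip (f i) (hf i) (h0 i) (h1 i)).equicontinuous
        (hlip g hg hg0 hg1).continuous
    · intro u v huv _ hu
      have hc : ∀ w : 𝓣 → ℝ, ∫ t, v t * w t ∂ν = ∫ t, u t * w t ∂ν := fun w =>
        integral_congr_ae (huv.mono fun t ht => by simp [ht])
      simpa only [hc] using hu
  have := key (Measure.integrable_toReal_rnDeriv (μ := m) (ν := ν))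
  simpa only [← smul_eq_mul, integral_rnDeriv_smul hmν] using this

end WeakLimit

/-! ### Finite-action rules: risks, compactness, minimax rules, convexity. -/

section Rules

variable {Θ 𝓣 𝓩 : Type*} [MeasurableSpace 𝓣] [MeasurableSpace 𝓩] {k : ℕ}

/-- The probability that the rule `σ` takes the action `a` when the observation has law `m`. -/
noncomputable def actionProb (m : Measure 𝓣) (σ : Kernel 𝓣 (Fin k)) (a : Fin k) : ℝ :=
  ∫ t, (σ t).real {a} ∂m

theorem measurable_real_singleton (σ : Kernel 𝓣 (Fin k)) (a : Fin k) :
    Measurable fun t => (σ t).real {a} :=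
  (Kernel.measurable_coe σ (measurableSet_singleton a)).ennreal_toReal

theorem integrable_real_singleton (m : Measure 𝓣) [IsFiniteMeasure m] (σ : Kernel 𝓣 (Fin k))
    [IsMarkovKernel σ] (a : Fin k) : Integrable (fun t => (σ t).real {a}) m :=
  integrable_of_mem_Icc m (measurable_real_singleton σ a) (fun _ => measureReal_nonneg)
    fun _ => measureReal_le_one

theorem sum_real_singleton (σ : Kernel 𝓣 (Fin k)) [IsMarkovKernel σ] (t : 𝓣) :
    ∑ a, (σ t).real {a} = 1 := by
  rw [sum_measureReal_singleton]; simp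

theorem sum_actionProb (m : Measure 𝓣) [IsProbabilityMeasure m] (σ : Kernel 𝓣 (Fin k))
    [IsMarkovKernel σ] : ∑ a, actionProb m σ a = 1 := by
  unfold actionProb
  rw [← integral_finsetSum _ fun a _ => integrable_real_singleton m σ a]
  simp

theorem actionProb_nonneg (m : Measure 𝓣) (σ : Kernel 𝓣 (Fin k)) (a : Fin k) :
    0 ≤ actionProb m σ a :=
  integral_nonneg fun _ => measureReal_nonneg

theorem risk_eq_sum (Q : Θ → Measure 𝓣) (hQ : ∀ θ, IsProbabilityMeasure (Q θ))
    (L : Θ → Fin k → ℝ) (σ : Kernel 𝓣 (Fin k)) [IsMarkovKernel σ] (θ : Θ) :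
    risk Q L σ θ = ∑ a, actionProb (Q θ) σ a * L θ a := by
  unfold risk actionProb
  simp_rw [integral_fintype Integrable.of_finite, smul_eq_mul, ← integral_mul_const]
  exact integral_finsetSum _ fun a _ => (integrable_real_singleton (Q θ) σ a).mul_const _

theorem risk_mem_Icc (Q : Θ → Measure 𝓣) (hQ : ∀ θ, IsProbabilityMeasure (Q θ))
    {L : Θ → Fin k → ℝ} (hL : IsUnitLoss L) (σ : Kernel 𝓣 (Fin k)) [IsMarkovKernel σ] (θ : Θ) :
    risk Q L σ θ ∈ Set.Icc (0 : ℝ) 1 := by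
  rw [risk_eq_sum Q hQ]
  refine ⟨Finset.sum_nonneg fun a _ => mul_nonneg (actionProb_nonneg _ _ _) (hL θ a).1, ?_⟩
  rw [← sum_actionProb (Q θ) σ]
  exact Finset.sum_le_sum fun a _ =>
    mul_le_of_le_one_right (actionProb_nonneg _ _ _) (hL θ a).2

theorem exists_kernel_of_weights (h : Fin k → 𝓣 → ℝ) (hm : ∀ a, Measurable (h a))
    (h0 : ∀ a t, 0 ≤ h a t) (h1 : ∀ t, ∑ a, h a t = 1) :
    ∃ σ : Kernel 𝓣 (Fin k), IsMarkovKernel σ ∧ ∀ t a, (σ t).real {a} = h a t := by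
  let μ : 𝓣 → Measure (Fin k) := fun t => ∑ a, ENNReal.ofReal (h a t) • Measure.dirac a
  have hμ : ∀ t s, μ t s = ∑ a, ENNReal.ofReal (h a t) * Measure.dirac a s := fun t s => by
    simp [μ]
  refine ⟨⟨μ, Measure.measurable_of_measurable_coe _ fun s _ => ?_⟩, ⟨fun t => ⟨?_⟩⟩,
    fun t a => ?_⟩
  · simp_rw [hμ]
    exact Finset.measurable_sum _ fun a _ => (hm a).ennreal_ofReal.mul_const _
  · change μ t Set.univ = 1
    rw [hμ]
    simp [← ENNReal.ofReal_sum_of_nonneg fun a _ => h0 a t, h1]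
  · change (μ t {a}).toReal = _
    rw [hμ, Finset.sum_eq_single a]
    · simp [h0]
    · intro b _ hb; simp [hb]
    · simp

/-- Rules with finitely many actions are compact, for the convergence of the action probabilities
under the finite measures dominated by `ν`. -/
theorem exists_tendsto_actionProb {ι : Type*} (ν : Measure 𝓣) [IsFiniteMeasure ν]
    (U : Ultrafilter ι) (σ : ι → Kernel 𝓣 (Fin k)) (hσ : ∀ i, IsMarkovKernel (σ i))
    (a₀ : Fin k) :
    ∃ τ : Kernel 𝓣 (Fin k), IsMarkovKernel τ ∧ ∀ a, ∀ m : Measure 𝓣, IsFiniteMeasure m →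
      m ≪ ν → Tendsto (fun i => actionProb m (σ i) a) U (𝓝 (actionProb m τ a)) := by
  choose g hg hg0 hg1 hlim using fun a => exists_tendsto_integral ν U
    (fun i t => (σ i t).real {a}) (fun i => measurable_real_singleton (σ i) a)
    (fun _ _ => measureReal_nonneg) (fun _ _ => measureReal_le_one)
  have hgi : ∀ a (m : Measure 𝓣) [IsFiniteMeasure m], Integrable (g a) m := fun a m _ =>
    integrable_of_mem_Icc m (hg a) (hg0 a) (hg1 a)
  have hsum : ∀ᵐ t ∂ν, ∑ a, g a t = 1 := by
    refine Integrable.ae_eq_of_forall_setIntegral_eq _ (fun _ => (1 : ℝ))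
      (integrable_finsetSum _ fun a _ => hgi a ν) (integrable_const _) fun s _ _ => ?_
    rw [integral_finsetSum _ fun a _ => hgi a (ν.restrict s)]
    have h := tendsto_finsetSum Finset.univ fun a _ =>
      hlim a (ν.restrict s) inferInstance Measure.absolutelyContinuous_restrict
    refine tendsto_nhds_unique h ?_
    refine tendsto_const_nhds.congr fun i => ?_
    rw [← integral_finsetSum _ fun a _ => integrable_real_singleton (ν.restrict s) (σ i) a]
    simp
  have hS : MeasurableSet {t | ∑ a, g a t = 1} :=
    measurableSet_eq_fun (Finset.measurable_sum _ fun a _ => hg a) measurable_const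
  classical
  obtain ⟨τ, hτ, hτg⟩ := exists_kernel_of_weights
    -- The limit weights sum to 1 only ν-almost everywhere; on the exceptional set the rule plays
    -- `a₀`.
    (fun a t => if ∑ b, g b t = 1 then g a t else if a = a₀ then 1 else 0)
    (fun a => Measurable.ite hS (hg a) measurable_const)
    (fun a t => by split_ifs <;> simp [hg0]) (fun t => by
      by_cases h : ∑ b, g b t = 1
      · simp [h]
      · simp [h])
  refine ⟨τ, hτ, fun a m hm hmν => ?_⟩
  have : actionProb m τ a = ∫ t, g a t ∂m := by
    refine integral_congr_ae ((hsum.filter_mono hmν.ae_le).mono fun t ht => ?_)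
    simp only [hτg]
    rw [if_pos ht]
  rw [this]
  exact hlim a m hm hmν

theorem exists_tendsto_risk {ι : Type*} {Q : Θ → Measure 𝓣}
    (hQ : ∀ θ, IsProbabilityMeasure (Q θ)) (ν : Measure 𝓣) [IsFiniteMeasure ν]
    (hν : ∀ θ, Q θ ≪ ν) (L : Θ → Fin k → ℝ) (U : Ultrafilter ι) (σ : ι → Kernel 𝓣 (Fin k))
    (hσ : ∀ i, IsMarkovKernel (σ i)) (a₀ : Fin k) :
    ∃ τ : Kernel 𝓣 (Fin k), IsMarkovKernel τ ∧
      ∀ θ, Tendsto (fun i => risk Q L (σ i) θ) U (𝓝 (risk Q L τ θ)) := by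
  obtain ⟨τ, hτ, h⟩ := exists_tendsto_actionProb ν U σ hσ a₀
  refine ⟨τ, hτ, fun θ => ?_⟩
  simp_rw [risk_eq_sum Q hQ]
  exact tendsto_finsetSum _ fun a _ => (h a (Q θ) inferInstance (hν θ)).mul_const _

theorem bddAbove_range_risk {Q : Θ → Measure 𝓣} (hQ : ∀ θ, IsProbabilityMeasure (Q θ))
    {L : Θ → Fin k → ℝ} (hL : IsUnitLoss L) (σ : Kernel 𝓣 (Fin k)) [IsMarkovKernel σ] :
    BddAbove (Set.range (risk Q L σ)) :=
  ⟨1, by rintro _ ⟨θ, rfl⟩; exact (risk_mem_Icc Q hQ hL σ θ).2⟩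

/-- In a dominated experiment, every decision problem with finitely many actions has a minimax
rule. -/
theorem exists_minimax [Nonempty Θ] {Q : Θ → Measure 𝓣} (hQ : ∀ θ, IsProbabilityMeasure (Q θ))
    (ν : Measure 𝓣) [IsFiniteMeasure ν] (hν : ∀ θ, Q θ ≪ ν) {L : Θ → Fin k → ℝ}
    (hL : IsUnitLoss L) (a₀ : Fin k) :
    ∃ σ₀ : Kernel 𝓣 (Fin k), IsMarkovKernel σ₀ ∧
      ∀ σ : Kernel 𝓣 (Fin k), IsMarkovKernel σ → worstRisk Q L σ₀ ≤ worstRisk Q L σ := by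
  let V : Set ℝ := {r | ∃ σ : Kernel 𝓣 (Fin k), IsMarkovKernel σ ∧ worstRisk Q L σ = r}
  have hne : V.Nonempty := ⟨_, Kernel.const 𝓣 (Measure.dirac a₀), inferInstance, rfl⟩
  have hbdd : BddBelow V := by
    refine ⟨0, ?_⟩
    rintro _ ⟨σ, _, rfl⟩
    exact Real.iSup_nonneg fun θ => (risk_mem_Icc Q hQ hL σ θ).1
  obtain ⟨u, -, hu, huV⟩ := exists_seq_tendsto_sInf hne hbdd
  choose σ hσ hσu using huV
  -- A limit of a minimizing sequence is minimax: the risk converges at each θ, so the worst-case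
  -- risk is lower semicontinuous.
  obtain ⟨τ, hτ, hlim⟩ := exists_tendsto_risk hQ ν hν L (Filter.hyperfilter ℕ) σ hσ a₀
  refine ⟨τ, hτ, fun σ' hσ' => le_trans ?_ (csInf_le hbdd ⟨σ', hσ', rfl⟩)⟩
  refine ciSup_le fun θ => ?_
  have hu' := hu.mono_left (Nat.hyperfilter_le_atTop)
  refine le_of_tendsto_of_tendsto' (hlim θ) hu' fun n => ?_
  rw [← hσu n]
  have := hσ n
  exact le_ciSup (bddAbove_range_risk hQ hL (σ n)) θ

theorem convex_range_actionProb {Q : Θ → Measure 𝓣} (hQ : ∀ θ, IsProbabilityMeasure (Q θ)) :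
    Convex ℝ {x : Θ × Fin k → ℝ | ∃ σ : Kernel 𝓣 (Fin k), IsMarkovKernel σ ∧
      ∀ θ a, actionProb (Q θ) σ a = x (θ, a)} := by
  rintro x ⟨σ, hσ, hx⟩ y ⟨τ, hτ, hy⟩ b c hb hc hbc
  obtain ⟨ω, hω, hωw⟩ := exists_kernel_of_weights
    (fun a t => b * (σ t).real {a} + c * (τ t).real {a})
    (fun a => ((measurable_real_singleton σ a).const_mul b).add
      ((measurable_real_singleton τ a).const_mul c))
    (fun a t => by positivity)
    (fun t => by
      rw [Finset.sum_add_distrib, ← Finset.mul_sum, ← Finset.mul_sum, sum_real_singleton,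
        sum_real_singleton, mul_one, mul_one, hbc])
  refine ⟨ω, hω, fun θ a => ?_⟩
  simp only [Pi.add_apply, Pi.smul_apply, smul_eq_mul, ← hx, ← hy]
  unfold actionProb
  simp_rw [hωw]
  rw [integral_add ((integrable_real_singleton (Q θ) σ a).const_mul b)
    ((integrable_real_singleton (Q θ) τ a).const_mul c), integral_const_mul, integral_const_mul]

end Rules

/-! ### Hahn-Banach separation by a loss function. -/

section Separation

variable {Θ 𝓣 𝓩 : Type*} [MeasurableSpace 𝓣] [MeasurableSpace 𝓩] {k : ℕ}

/-- If no decision problem separates the rules for `Q` from the rule `ρ` for `P`, then, on finitely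
many parameters, the action probabilities of `ρ` are approximated by those of rules for `Q`. -/
theorem exists_actionProb_near {Q : Θ → Measure 𝓣} {P : Θ → Measure 𝓩}
    (hQ : ∀ θ, IsProbabilityMeasure (Q θ)) (hP : ∀ θ, IsProbabilityMeasure (P θ))
    (ρ : Kernel 𝓩 (Fin k)) [IsMarkovKernel ρ]
    (H : ∀ L : Θ → Fin k → ℝ, IsUnitLoss L → ∀ γ > 0, ∃ σ : Kernel 𝓣 (Fin k),
      IsMarkovKernel σ ∧ ∀ θ, risk Q L σ θ - risk P L ρ θ < γ)
    (F : Finset Θ) {ε : ℝ} (hε : 0 < ε) :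
    ∃ σ : Kernel 𝓣 (Fin k), IsMarkovKernel σ ∧
      ∀ θ ∈ F, ∀ a, |actionProb (Q θ) σ a - actionProb (P θ) ρ a| < ε := by
  classical
  let W : Set (F × Fin k → ℝ) := {x | ∃ σ : Kernel 𝓣 (Fin k), IsMarkovKernel σ ∧
      ∀ (θ : F) a, actionProb (Q θ) σ a = x (θ, a)}
  have hW : Convex ℝ W := convex_range_actionProb (Q := fun θ : F => Q θ) fun θ => hQ θ
  let p : F × Fin k → ℝ := fun j => actionProb (P j.1) ρ j.2
  by_cases hp : p ∈ closure W
  · obtain ⟨x, ⟨σ, hσ, hx⟩, hd⟩ := Metric.mem_closure_iff.1 hp ε hε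
    refine ⟨σ, hσ, fun θ hθ a => ?_⟩
    have := (dist_pi_lt_iff hε).1 hd (⟨θ, hθ⟩, a)
    rwa [dist_comm, Real.dist_eq, ← hx] at this
  exfalso
  obtain ⟨f, u, hfp, hfW⟩ := geometric_hahn_banach_point_closed hW.closure isClosed_closure hp
  let l : F → Fin k → ℝ := fun θ a => f (Pi.single (θ, a) 1)
  have hf : ∀ x : F × Fin k → ℝ, f x = ∑ θ : F, ∑ a, x (θ, a) * l θ a := by
    intro x
    rw [← Fintype.sum_prod_type' (f := fun θ a => x (θ, a) * l θ a)]
    conv_lhs => rw [pi_eq_sum_univ' x]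
    rw [map_sum]
    refine Finset.sum_congr rfl fun j _ => ?_
    rw [map_smul, smul_eq_mul]
  obtain ⟨M, hM0, hlM⟩ : ∃ M : ℝ, 0 < M ∧ ∀ θ a, |l θ a| ≤ M := by
    refine ⟨1 + ∑ θ : F, ∑ a, |l θ a|, by positivity, fun θ a => ?_⟩
    have h1 := Finset.single_le_sum (f := fun a => |l θ a|) (fun _ _ => abs_nonneg _)
      (Finset.mem_univ a)
    have h2 := Finset.single_le_sum (f := fun θ => ∑ a, |l θ a|)
      (fun _ _ => Finset.sum_nonneg fun _ _ => abs_nonneg _) (Finset.mem_univ θ)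
    linarith
  -- The separating functional, rescaled into [0, 1], serves as a loss. Action probabilities sum to
  -- 1, so the rescaling changes each risk only by a common factor and the constant 1/2.
  let L : Θ → Fin k → ℝ := fun θ a => if h : θ ∈ F then (l ⟨θ, h⟩ a / M + 1) / 2 else 0
  have hL : IsUnitLoss L := by
    intro θ a
    by_cases h : θ ∈ F
    · have := abs_le.1 (hlM ⟨θ, h⟩ a)
      have h1 : -1 ≤ l ⟨θ, h⟩ a / M := by rw [le_div_iff₀ hM0]; linarith
      have h2 : l ⟨θ, h⟩ a / M ≤ 1 := by rw [div_le_iff₀ hM0]; linarith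
      simp only [L, dif_pos h, Set.mem_Icc]
      constructor <;> linarith
    · simp [L, h]
  have hLF : ∀ (θ : F) a, L θ a = (l θ a / M + 1) / 2 := fun θ a => by
    simp only [L]; rw [dif_pos θ.2]
  have hrisk : ∀ (θ : F) (c : Fin k → ℝ), ∑ a, c a = 1 →
      ∑ a, c a * L θ a = (2 * M)⁻¹ * (∑ a, c a * l θ a) + 1 / 2 := by
    intro θ c hc
    have : (1 : ℝ) / 2 = ∑ a, c a * (1 / 2) := by rw [← Finset.sum_mul, hc, one_mul]
    rw [this, Finset.mul_sum, ← Finset.sum_add_distrib]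
    refine Finset.sum_congr rfl fun a _ => ?_
    rw [hLF]; field_simp
  -- The rescaled gap is shared among the parameters, so that margins below this, summed over F,
  -- cannot reach it. The + 1 covers empty F.
  have hγ : 0 < (2 * M)⁻¹ * (u - f p) / (F.card + 1) :=
    div_pos (mul_pos (by positivity) (by linarith)) (Nat.cast_add_one_pos _)
  obtain ⟨σ, hσ, hσr⟩ := H L hL _ hγ
  have hsep := hfW (fun j => actionProb (Q j.1) σ j.2)
    (subset_closure ⟨σ, hσ, fun _ _ => rfl⟩)
  have hsum : ∑ θ : F, (risk Q L σ θ - risk P L ρ θ)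
      = (2 * M)⁻¹ * (f (fun j => actionProb (Q j.1) σ j.2) - f p) := by
    rw [hf, hf, ← Finset.sum_sub_distrib, Finset.mul_sum]
    refine Finset.sum_congr rfl fun θ _ => ?_
    rw [risk_eq_sum Q hQ, risk_eq_sum P hP, hrisk θ _ (sum_actionProb _ σ),
      hrisk θ _ (sum_actionProb _ ρ)]
    ring
  have hle : ∑ θ : F, (risk Q L σ θ - risk P L ρ θ)
      ≤ F.card * ((2 * M)⁻¹ * (u - f p) / (F.card + 1)) := by
    have := Finset.sum_le_card_nsmul (Finset.univ : Finset F)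
      (fun θ => risk Q L σ θ - risk P L ρ θ) _ fun θ _ => (hσr θ).le
    rwa [Finset.card_univ, Fintype.card_coe, nsmul_eq_mul] at this
  have h1 : (2 * M)⁻¹ * (u - f p) < (2 * M)⁻¹ * (f (fun j => actionProb (Q j.1) σ j.2) - f p) :=
    mul_lt_mul_of_pos_left (by linarith) (by positivity)
  have h2 : (F.card : ℝ) * ((2 * M)⁻¹ * (u - f p) / (F.card + 1)) ≤ (2 * M)⁻¹ * (u - f p) := by
    rw [mul_div_assoc', div_le_iff₀ (Nat.cast_add_one_pos _)]
    have : 0 < (2 * M)⁻¹ * (u - f p) := mul_pos (by positivity) (by linarith)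
    linarith
  linarith

end Separation

/-! ### The randomization criterion: from approximating rules to a Markov kernel. -/

section RandomizationCriterion

variable {Θ 𝓣 𝓩 : Type*} [MeasurableSpace 𝓣] [MeasurableSpace 𝓩]

/-- The limits at ±∞ and right continuity hold for the averages, which form the cdf of R. For
monotone sequences bounded by the candidate limit, convergence of the integrals forces almost
everywhere convergence. -/
theorem ae_isRatStieltjesPoint {m : Measure 𝓣} [IsProbabilityMeasure m] {R : Measure ℝ}
    [IsProbabilityMeasure R] {f : 𝓣 → ℚ → ℝ} (hf : ∀ q, Measurable fun t => f t q)
    (h0 : ∀ t q, 0 ≤ f t q) (h1 : ∀ t q, f t q ≤ 1)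
    (hmono : ∀ q r, q ≤ r → ∀ᵐ t ∂m, f t q ≤ f t r)
    (hint : ∀ q : ℚ, ∫ t, f t q ∂m = R.real (Set.Iic (q : ℝ))) :
    ∀ᵐ t ∂m, IsRatStieltjesPoint f t := by
  have hfi : ∀ q, Integrable (fun t => f t q) m := fun q =>
    integrable_of_mem_Icc m (hf q) (fun t => h0 t q) (fun t => h1 t q)
  have hm : ∀ᵐ t ∂m, Monotone (f t) := by
    unfold Monotone
    simp_rw [ae_all_iff]
    exact hmono
  have hcdf : ∀ q : ℚ, ∫ t, f t q ∂m = cdf R q := fun q => by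
    rw [hint, cdf_eq_real]
  have htop : ∀ᵐ t ∂m, Tendsto (f t) atTop (𝓝 1) := by
    have : ∀ᵐ t ∂m, Tendsto (fun n : ℕ => f t n) atTop (𝓝 1) := by
      refine tendsto_of_integral_tendsto_of_monotone (fun n => hfi n) (integrable_const _) ?_ ?_
        (ae_of_all _ fun t n => h1 t n)
      · simp_rw [hcdf]
        simpa [Function.comp_def] using (tendsto_cdf_atTop R).comp
          (tendsto_natCast_atTop_atTop (R := ℝ))
      · filter_upwards [hm] with t ht using fun a b hab => ht (Nat.cast_le.2 hab)
    filter_upwards [this, hm] with t ht hmt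
    rwa [tendsto_iff_tendsto_subseq_of_monotone hmt tendsto_natCast_atTop_atTop]
  have hbot : ∀ᵐ t ∂m, Tendsto (f t) atBot (𝓝 0) := by
    have : ∀ᵐ t ∂m, Tendsto (fun n : ℕ => f t (-n)) atTop (𝓝 0) := by
      refine tendsto_of_integral_tendsto_of_antitone (fun n => hfi (-n)) (integrable_const _) ?_ ?_
        (ae_of_all _ fun t n => h0 t (-n))
      · simp_rw [hcdf]
        simpa [Function.comp_def] using (tendsto_cdf_atBot R).comp
          (tendsto_neg_atBot_iff.mpr (tendsto_natCast_atTop_atTop (R := ℝ)))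
      · filter_upwards [hm] with t ht using fun a b hab => ht (neg_le_neg (Nat.cast_le.2 hab))
    filter_upwards [this, hm] with t ht hmt
    have hanti : Antitone (fun q => f t (-q)) := hmt.comp_antitone monotone_id.neg
    exact tendsto_comp_neg_atTop_iff.mp
      ((tendsto_iff_tendsto_subseq_of_antitone hanti tendsto_natCast_atTop_atTop).mpr ht)
  have hright : ∀ᵐ t ∂m, ∀ q : ℚ, Tendsto (fun n : ℕ => f t (q + 1 / (n + 1))) atTop
      (𝓝 (f t q)) := by
    refine ae_all_iff.2 fun q => ?_
    have hanti : Antitone fun n : ℕ => q + 1 / ((n : ℚ) + 1) := fun a b hab => by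
      dsimp only
      gcongr
    refine tendsto_of_integral_tendsto_of_antitone (fun n => hfi _) (hfi q) ?_ ?_ ?_
    · simp_rw [hcdf]
      have hc := (cdf R).right_continuous q
      refine hc.tendsto.comp (tendsto_nhdsWithin_iff.2 ⟨?_, Eventually.of_forall fun n => ?_⟩)
      · have := (tendsto_one_div_add_atTop_nhds_zero_nat (𝕜 := ℝ)).const_add (q : ℝ)
        simpa using this
      · simp only [Set.mem_Ici, Rat.cast_le]
        exact le_add_of_nonneg_right (by positivity)
    · filter_upwards [hm] with t ht using ht.comp_antitone hanti
    · filter_upwards [hm] with t ht using fun n => ht (le_add_of_nonneg_right (by positivity))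
  filter_upwards [hm, htop, hbot, hright] with t hmt htt hbt hrt
  refine ⟨hmt, htt, hbt, fun q => le_antisymm ?_ ?_⟩
  · refine ge_of_tendsto' (hrt q) fun n => ?_
    exact ciInf_le ⟨0, by rintro _ ⟨r, rfl⟩; exact h0 t r⟩
      (⟨q + 1 / (n + 1), by simp only [Set.mem_Ioi]; exact lt_add_of_pos_right _ (by positivity)⟩ :
        Set.Ioi q)
  · have : Nonempty (Set.Ioi q) := ⟨⟨q + 1, by simp⟩⟩
    exact le_ciInf fun r => hmt (le_of_lt r.2)

/-- A family of rational distribution functions reproducing the laws `R θ` gives a Markov kernel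
carrying each `Q θ` to `R θ`. -/
theorem blackwellSufficient_of_ratCDF {Q : Θ → Measure 𝓣} {R : Θ → Measure ℝ}
    (hQ : ∀ θ, IsProbabilityMeasure (Q θ)) (hR : ∀ θ, IsProbabilityMeasure (R θ))
    {f : 𝓣 → ℚ → ℝ} (hf : ∀ q, Measurable fun t => f t q)
    (h0 : ∀ t q, 0 ≤ f t q) (h1 : ∀ t q, f t q ≤ 1)
    (hmono : ∀ θ q r, q ≤ r → ∀ᵐ t ∂(Q θ), f t q ≤ f t r)
    (hint : ∀ θ, ∀ q : ℚ, ∫ t, f t q ∂(Q θ) = (R θ).real (Set.Iic (q : ℝ))) :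
    BlackwellSufficient Q R := by
  have hfm : Measurable f := measurable_pi_iff.2 hf
  let K : Kernel 𝓣 ℝ := ⟨fun t => (stieltjesOfMeasurableRat f hfm t).measure,
    measurable_measure_stieltjesOfMeasurableRat hfm⟩
  have hK : IsMarkovKernel K :=
    ⟨fun t => ⟨measure_stieltjesOfMeasurableRat_univ hfm t⟩⟩
  refine ⟨K, hK, fun θ => ?_⟩
  refine ext_of_generate_finite _ Real.borel_eq_generateFrom_Iic_rat Real.isPiSystem_Iic_rat ?_ ?_
  · intro s hs
    simp only [Set.mem_iUnion, Set.mem_singleton_iff] at hs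
    obtain ⟨q, rfl⟩ := hs
    rw [Measure.bind_apply measurableSet_Iic K.measurable.aemeasurable]
    -- Where `f t` is not a rational cdf, K uses a default distribution function; this set is null
    -- for each `Q θ`.
    have hae : ∀ᵐ t ∂(Q θ), K t (Set.Iic (q : ℝ)) = ENNReal.ofReal (f t q) := by
      filter_upwards [ae_isRatStieltjesPoint hf h0 h1 (hmono θ) (hint θ)] with t ht
      change (stieltjesOfMeasurableRat f hfm t).measure _ = _
      rw [measure_stieltjesOfMeasurableRat_Iic, stieltjesOfMeasurableRat_eq,
        toRatCDF_of_isRatStieltjesPoint ht]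
    rw [lintegral_congr_ae hae, ← ofReal_integral_eq_lintegral_ofReal
      (integrable_of_mem_Icc _ (hf q) (fun t => h0 t q) (fun t => h1 t q))
      (ae_of_all _ fun t => h0 t q), hint, ofReal_measureReal]
  · simp

/-- A measurable left inverse of e carries the kernel back, which reduces the criterion to
real-valued data. -/
theorem BlackwellSufficient.of_map {Q : Θ → Measure 𝓣} {P : Θ → Measure 𝓩} [Nonempty 𝓩]
    {e : 𝓩 → ℝ} (he : MeasurableEmbedding e)
    (h : BlackwellSufficient Q fun θ => (P θ).map e) : BlackwellSufficient Q P := by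
  obtain ⟨K, hK, hKQ⟩ := h
  obtain ⟨g, hg, hge⟩ := he.exists_measurable_extend measurable_id fun _ => ‹Nonempty 𝓩›
  refine ⟨K.map g, Kernel.IsMarkovKernel.map K hg, fun θ => ?_⟩
  rw [← Measure.map_comp (Q θ) K hg, hKQ, Measure.map_map hg he.measurable, hge, Measure.map_id]

theorem integral_real_finset (m : Measure 𝓣) [IsFiniteMeasure m] {k : ℕ} (σ : Kernel 𝓣 (Fin k))
    [IsMarkovKernel σ] (S : Finset (Fin k)) :
    ∫ t, (σ t).real S ∂m = ∑ a ∈ S, actionProb m σ a := by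
  unfold actionProb
  rw [← integral_finsetSum _ fun a _ => integrable_real_singleton m σ a]
  simp_rw [sum_measureReal_singleton]

/-- The number of thresholds in `D` that lie below `e z`. -/
noncomputable def rankBelow (D : Finset ℚ) (x : ℝ) : Fin (D.card + 1) :=
  ⟨(D.filter fun d : ℚ => (d : ℝ) < x).card, Nat.lt_succ_of_le (Finset.card_filter_le _ _)⟩

theorem measurable_rankBelow (D : Finset ℚ) : Measurable (rankBelow D) := by
  have h : Measurable fun x : ℝ => (D.filter fun d : ℚ => (d : ℝ) < x).card := by
    simp_rw [Finset.card_filter]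
    exact Finset.measurable_sum _ fun d _ =>
      Measurable.ite measurableSet_Ioi measurable_const measurable_const
  refine measurable_to_countable' fun a => ?_
  have : rankBelow D ⁻¹' {a} =
      (fun x : ℝ => (D.filter fun d : ℚ => (d : ℝ) < x).card) ⁻¹' {a.val} := by
    ext x; simp [rankBelow, Fin.ext_iff]
  rw [this]
  exact h (measurableSet_singleton _)

/-- The ranks of the points up to `q`. -/
def ranksUpTo (D : Finset ℚ) (q : ℚ) : Finset (Fin (D.card + 1)) :=
  Finset.univ.filter fun a => a.val ≤ (D.filter (· < q)).card

theorem ranksUpTo_mono (D : Finset ℚ) {q r : ℚ} (h : q ≤ r) : ranksUpTo D q ⊆ ranksUpTo D r := by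
  intro a ha
  simp only [ranksUpTo, Finset.mem_filter, Finset.mem_univ, true_and] at ha ⊢
  exact ha.trans (Finset.card_le_card
    (Finset.monotone_filter_right _ fun d _ hd => lt_of_lt_of_le hd h))

/-- If x > q, then q itself is counted besides all thresholds below it, so the rank is too large.
This needs q to be a threshold. -/
theorem rankBelow_mem_ranksUpTo {D : Finset ℚ} {q : ℚ} (hq : q ∈ D) (x : ℝ) :
    rankBelow D x ∈ ranksUpTo D q ↔ x ≤ q := by
  simp only [ranksUpTo, rankBelow, Finset.mem_filter, Finset.mem_univ, true_and]
  constructor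
  · intro h
    by_contra! hx
    refine absurd h (not_le.2 (Finset.card_lt_card ?_))
    refine (Finset.ssubset_iff_of_subset ?_).2 ⟨q, by simp [hq, hx], by simp⟩
    exact Finset.monotone_filter_right _ fun d _ hd => (Rat.cast_lt.2 hd).trans hx
  · intro hx
    exact Finset.card_le_card
      (Finset.monotone_filter_right _ fun d _ hd => Rat.cast_lt.1 (lt_of_lt_of_le hd hx))

/-- Randomization criterion: if no decision problem separates the two experiments, then `Q` is
Blackwell-sufficient for `P`. -/
theorem blackwellSufficient_of_not_separated [StandardBorelSpace 𝓩] [Nonempty Θ]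
    {Q : Θ → Measure 𝓣} {P : Θ → Measure 𝓩}
    (hQ : ∀ θ, IsProbabilityMeasure (Q θ)) (hP : ∀ θ, IsProbabilityMeasure (P θ))
    (ν : Measure 𝓣) [IsFiniteMeasure ν] (hν : ∀ θ, Q θ ≪ ν)
    (H : ∀ (k : ℕ) (L : Θ → Fin k → ℝ), IsUnitLoss L →
      ∀ ρ : Kernel 𝓩 (Fin k), IsMarkovKernel ρ → ∀ γ > 0, ∃ σ : Kernel 𝓣 (Fin k),
        IsMarkovKernel σ ∧ ∀ θ, risk Q L σ θ - risk P L ρ θ < γ) :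
    BlackwellSufficient Q P := by
  classical
  have hne : Nonempty 𝓩 := nonempty_of_isProbabilityMeasure (P (Classical.arbitrary Θ))
  obtain ⟨e, he⟩ := exists_measurableEmbedding_real 𝓩
  refine BlackwellSufficient.of_map he ?_
  let ρ : (D : Finset ℚ) → Kernel 𝓩 (Fin (D.card + 1)) := fun D =>
    Kernel.deterministic (fun z => rankBelow D (e z)) ((measurable_rankBelow D).comp he.measurable)
  have hρ : ∀ D, IsMarkovKernel (ρ D) := fun D => inferInstance
  -- There are `D.card + 1` ranks, so errors summed over any set of ranks stay below 1 / (n + 1).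
  let ε : Finset Θ × Finset ℚ × ℕ → ℝ := fun i => 1 / ((i.2.2 + 1) * (i.2.1.card + 1))
  have hε : ∀ i, 0 < ε i := fun i => by positivity
  choose σ hσ hσρ using fun i : Finset Θ × Finset ℚ × ℕ =>
    exists_actionProb_near hQ hP (ρ i.2.1) (fun L hL γ hγ => H _ L hL _ (hρ i.2.1) γ hγ) i.1 (hε i)
  let f : ℚ → Finset Θ × Finset ℚ × ℕ → 𝓣 → ℝ := fun q i t =>
    (σ i t).real (ranksUpTo i.2.1 q)
  have hfm : ∀ q i, Measurable (f q i) := fun q i =>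
    (Kernel.measurable_coe (σ i) (Finset.measurableSet _)).ennreal_toReal
  -- Along U, any given parameter and threshold are eventually included, and the error tends to 0.
  let U : Ultrafilter (Finset Θ × Finset ℚ × ℕ) := Ultrafilter.of atTop
  choose g hg hg0 hg1 hlim using fun q => exists_tendsto_integral ν U (f q) (hfm q)
    (fun _ _ => measureReal_nonneg) (fun _ _ => measureReal_le_one)
  refine blackwellSufficient_of_ratCDF (f := fun t q => g q t) hQ
    (fun θ => Measure.isProbabilityMeasure_map he.measurable.aemeasurable) hg
    (fun t q => hg0 q t) (fun t q => hg1 q t) (fun θ q r hqr => ?_) (fun θ q => ?_)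
  · have hgi : ∀ q, Integrable (g q) (Q θ) := fun q =>
      integrable_of_mem_Icc _ (hg q) (hg0 q) (hg1 q)
    refine ae_le_of_forall_setIntegral_le (hgi q) (hgi r) fun s _ _ => ?_
    have hs : (Q θ).restrict s ≪ ν := Measure.absolutelyContinuous_restrict.trans (hν θ)
    refine le_of_tendsto_of_tendsto' (hlim q _ inferInstance hs) (hlim r _ inferInstance hs)
      fun i => integral_mono ?_ ?_ fun t => ?_
    · exact integrable_of_mem_Icc _ (hfm q i) (fun _ => measureReal_nonneg)
        fun _ => measureReal_le_one
    · exact integrable_of_mem_Icc _ (hfm r i) (fun _ => measureReal_nonneg)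
        fun _ => measureReal_le_one
    · exact measureReal_mono (Finset.coe_subset.2 (ranksUpTo_mono _ hqr))
  · refine tendsto_nhds_unique (hlim q (Q θ) inferInstance (hν θ))
      (Tendsto.mono_left ?_ (Ultrafilter.of_le atTop))
    rw [map_measureReal_apply he.measurable measurableSet_Iic, Metric.tendsto_atTop]
    intro δ hδ
    obtain ⟨n, hn⟩ := exists_nat_one_div_lt hδ
    refine ⟨({θ}, {q}, n), fun i hi => ?_⟩
    have hθ : θ ∈ i.1 := hi.1 (Finset.mem_singleton_self θ)
    have hq : q ∈ i.2.1 := hi.2.1 (Finset.mem_singleton_self q)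
    have hni : n ≤ i.2.2 := hi.2.2
    have hPq : (P θ).real (e ⁻¹' Set.Iic (q : ℝ)) =
        ∑ a ∈ ranksUpTo i.2.1 q, actionProb (P θ) (ρ i.2.1) a := by
      rw [← integral_real_finset, ← integral_indicator_one (he.measurable measurableSet_Iic)]
      congr 1 with z
      have := rankBelow_mem_ranksUpTo hq (e z)
      by_cases hz : e z ≤ q
      · simp [ρ, Kernel.deterministic_apply, measureReal_def, this, hz]
      · simp [ρ, Kernel.deterministic_apply, measureReal_def, this, hz]
    have hfi : ∫ t, f q i t ∂(Q θ) = ∑ a ∈ ranksUpTo i.2.1 q, actionProb (Q θ) (σ i) a := by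
      have := hσ i
      exact integral_real_finset _ _ _
    rw [hPq, hfi, Real.dist_eq, ← Finset.sum_sub_distrib]
    refine lt_of_le_of_lt ?_ hn
    calc |∑ a ∈ ranksUpTo i.2.1 q, (actionProb (Q θ) (σ i) a - actionProb (P θ) (ρ i.2.1) a)|
        ≤ ∑ a ∈ ranksUpTo i.2.1 q, ε i := (Finset.abs_sum_le_sum_abs _ _).trans
          (Finset.sum_le_sum fun a _ => (hσρ i θ hθ a).le)
      _ = (ranksUpTo i.2.1 q).card * ε i := by rw [Finset.sum_const, nsmul_eq_mul]
      _ ≤ (i.2.1.card + 1) * ε i := by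
          refine mul_le_mul_of_nonneg_right ?_ (hε i).le
          exact_mod_cast (Finset.card_le_univ _).trans_eq (Fintype.card_fin _)
      _ = 1 / (i.2.2 + 1) := by simp only [ε]; field_simp
      _ ≤ 1 / (n + 1) := by gcongr

end RandomizationCriterion

/-! ### From a separating problem to deficiency and uniform domination. -/

section Domination

variable {Θ 𝓣 𝓩 : Type*} [MeasurableSpace 𝓣] [MeasurableSpace 𝓩] {k : ℕ}

theorem actionProb_eq_measureReal (m : Measure 𝓣) (σ : Kernel 𝓣 (Fin k)) [IsMarkovKernel σ]
    (a : Fin k) : actionProb m σ a = (σ ∘ₘ m).real {a} := by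
  have hs := measurableSet_singleton a
  rw [measureReal_def, Measure.bind_apply hs σ.measurable.aemeasurable]
  exact integral_toReal (Kernel.measurable_coe σ hs).aemeasurable
    (ae_of_all _ fun t => measure_lt_top _ _)

/-- A rule for the garbled experiment can be simulated from the full data by first applying M; this
gives clause (a) of domination. -/
theorem risk_comp {P : Θ → Measure 𝓩} (hP : ∀ θ, IsProbabilityMeasure (P θ))
    (M : Kernel 𝓩 𝓣) [IsMarkovKernel M] (L : Θ → Fin k → ℝ) (σ : Kernel 𝓣 (Fin k))
    [IsMarkovKernel σ] (θ : Θ) :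
    risk P L (σ ∘ₖ M) θ = risk (fun θ => M ∘ₘ P θ) L σ θ := by
  rw [risk_eq_sum P hP, risk_eq_sum _ fun θ => inferInstance]
  simp_rw [actionProb_eq_measureReal, Measure.comp_assoc]

theorem risk_map (Q : Θ → Measure 𝓣) {n : ℕ} (L : Θ → Fin n → ℝ) (σ : Kernel 𝓣 (Fin k))
    (j : Fin k → Fin n) (θ : Θ) :
    risk Q L (σ.map j) θ = risk Q (fun θ a => L θ (j a)) σ θ := by
  unfold risk
  congr 1 with t
  rw [Kernel.map_apply _ Measurable.of_discrete]
  exact integral_map Measurable.of_discrete.aemeasurable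
    Measurable.of_discrete.aestronglyMeasurable

theorem risk_affine (Q : Θ → Measure 𝓣) (hQ : ∀ θ, IsProbabilityMeasure (Q θ))
    (L : Θ → Fin k → ℝ) (σ : Kernel 𝓣 (Fin k)) [IsMarkovKernel σ] (c : ℝ) (d : Θ → ℝ) (θ : Θ) :
    risk Q (fun θ a => c * L θ a + d θ) σ θ = c * risk Q L σ θ + d θ := by
  rw [risk_eq_sum Q hQ, risk_eq_sum Q hQ, Finset.mul_sum]
  simp_rw [mul_add, Finset.sum_add_distrib, ← Finset.sum_mul, sum_actionProb, one_mul]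
  congr 1
  exact Finset.sum_congr rfl fun a _ => by ring

theorem risk_mono_loss (Q : Θ → Measure 𝓣) (hQ : ∀ θ, IsProbabilityMeasure (Q θ))
    {L L' : Θ → Fin k → ℝ} (h : ∀ θ a, L θ a ≤ L' θ a) (σ : Kernel 𝓣 (Fin k)) [IsMarkovKernel σ]
    (θ : Θ) : risk Q L σ θ ≤ risk Q L' σ θ := by
  rw [risk_eq_sum Q hQ, risk_eq_sum Q hQ]
  exact Finset.sum_le_sum fun a _ => mul_le_mul_of_nonneg_left (h θ a) (actionProb_nonneg _ _ _)

theorem nonempty_actions [Nonempty Θ] {P : Θ → Measure 𝓩} (hP : ∀ θ, IsProbabilityMeasure (P θ))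
    (ρ : Kernel 𝓩 (Fin k)) [IsMarkovKernel ρ] : Nonempty (Fin k) := by
  obtain ⟨z⟩ := nonempty_of_isProbabilityMeasure (P (Classical.arbitrary Θ))
  exact nonempty_of_isProbabilityMeasure (ρ z)

theorem deficiency_ge_of_separated [Nonempty Θ] {Q : Θ → Measure 𝓣} {P : Θ → Measure 𝓩}
    (hQ : ∀ θ, IsProbabilityMeasure (Q θ)) (hP : ∀ θ, IsProbabilityMeasure (P θ))
    {L : Θ → Fin k → ℝ} (hL : IsUnitLoss L) (ρ : Kernel 𝓩 (Fin k)) [IsMarkovKernel ρ] {γ : ℝ}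
    (hsep : ∀ σ : Kernel 𝓣 (Fin k), IsMarkovKernel σ →
      ∃ θ, γ ≤ risk Q L σ θ - risk P L ρ θ) :
    γ ≤ deficiency Q P := by
  -- The set of admissible ε contains 1, so its `sInf` is a genuine infimum.
  refine le_csInf ⟨1, zero_le_one, fun n L' hL' ρ' hρ' => ?_⟩ ?_
  · obtain ⟨a⟩ := nonempty_actions hP ρ'
    refine ⟨Kernel.const 𝓣 (Measure.dirac a), inferInstance, fun θ => ?_⟩
    have h1 := (risk_mem_Icc Q hQ hL' (Kernel.const 𝓣 (Measure.dirac a)) θ).2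
    have h2 := (risk_mem_Icc P hP hL' ρ' θ).1
    linarith
  · rintro ε ⟨-, hε⟩
    obtain ⟨σ, hσ, hσε⟩ := hε k L hL ρ inferInstance
    obtain ⟨θ, hθ⟩ := hsep σ hσ
    exact hθ.trans (hσε θ)

/-- A separating decision problem can be turned into one with uniform domination: the loss is
shifted so that `ρ` has constant risk, and dominated copies of the actions are added that level the
risk of a minimax rule. -/
theorem exists_uniformlyDominatedOn [Nonempty Θ] {P : Θ → Measure 𝓩}
    (hP : ∀ θ, IsProbabilityMeasure (P θ)) (M : Kernel 𝓩 𝓣) [IsMarkovKernel M]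
    {Q : Θ → Measure 𝓣} (hQM : ∀ θ, Q θ = M ∘ₘ P θ) (ν : Measure 𝓣) [IsFiniteMeasure ν]
    (hν : ∀ θ, Q θ ≪ ν) {L : Θ → Fin k → ℝ} (hL : IsUnitLoss L) (ρ : Kernel 𝓩 (Fin k))
    [IsMarkovKernel ρ] {γ : ℝ} (hγ : 0 < γ)
    (hsep : ∀ σ : Kernel 𝓣 (Fin k), IsMarkovKernel σ →
      ∃ θ, γ ≤ risk Q L σ θ - risk P L ρ θ) :
    ∃ (n : ℕ) (L' : Θ → Fin n → ℝ), IsUnitLoss L' ∧ UniformlyDominatedOn Q P L' := by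
  obtain rfl : Q = fun θ => M ∘ₘ P θ := funext hQM
  set Q : Θ → Measure 𝓣 := fun θ => M ∘ₘ P θ
  have hQ : ∀ θ, IsProbabilityMeasure (Q θ) := fun θ => inferInstance
  obtain ⟨a₀⟩ := nonempty_actions hP ρ
  -- The shift gives ρ the constant risk 1/4. The factors 1/4 keep l at most 1/2, leaving room for a
  -- further surcharge of at most 1/2.
  let l : Θ → Fin k → ℝ := fun θ a => 1 / 4 * L θ a + (1 - risk P L ρ θ) / 4
  have hl : ∀ θ a, 0 ≤ l θ a ∧ l θ a ≤ 1 / 2 := fun θ a => by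
    have h1 := hL θ a
    have h2 := risk_mem_Icc P hP hL ρ θ
    simp only [l]
    constructor <;> linarith [h1.1, h1.2, h2.1, h2.2]
  have hlu : IsUnitLoss l := fun θ a => ⟨(hl θ a).1, by linarith [(hl θ a).2]⟩
  have hlρ : ∀ θ, risk P l ρ θ = 1 / 4 := fun θ => by
    rw [risk_affine P hP L ρ (1 / 4) fun θ => (1 - risk P L ρ θ) / 4]; ring
  have hlσ : ∀ (σ : Kernel 𝓣 (Fin k)) [IsMarkovKernel σ] θ,
      risk Q l σ θ = 1 / 4 + (risk Q L σ θ - risk P L ρ θ) / 4 := fun σ _ θ => by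
    rw [risk_affine Q hQ L σ (1 / 4) fun θ => (1 - risk P L ρ θ) / 4]; ring
  obtain ⟨σ₀, hσ₀, hmin⟩ := exists_minimax hQ ν hν hlu a₀
  let v : ℝ := worstRisk Q l σ₀
  let w : Θ → ℝ := risk Q l σ₀
  have hwv : ∀ θ, w θ ≤ v := le_ciSup (bddAbove_range_risk hQ hlu σ₀)
  have hw0 : ∀ θ, 0 ≤ w θ := fun θ => (risk_mem_Icc Q hQ hlu σ₀ θ).1
  have hv : v ≤ 1 / 2 := ciSup_le fun θ => by
    refine (risk_mono_loss Q hQ (L' := fun _ _ => 1 / 2) (fun θ a => (hl θ a).2) σ₀ θ).trans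
      (le_of_eq ?_)
    simpa using risk_affine Q hQ (fun _ _ => 0) σ₀ 0 (fun _ => 1 / 2) θ
  have hvγ : 1 / 4 + γ / 4 ≤ v := by
    obtain ⟨θ, hθ⟩ := hsep σ₀ hσ₀
    have := hwv θ
    simp only [w, hlσ] at this
    linarith
  let e : Fin k × Bool ≃ Fin (Fintype.card (Fin k × Bool)) := Fintype.equivFin _
  -- The copy of an action flagged `true` costs `v - w θ` more, which raises the risk of `σ₀` to v
  -- at every θ.
  let L' : Θ → Fin (Fintype.card (Fin k × Bool)) → ℝ := fun θ b =>
    l θ (e.symm b).1 + if (e.symm b).2 then v - w θ else 0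
  have hL' : IsUnitLoss L' := fun θ b => by
    have h1 := hl θ (e.symm b).1
    have h2 := hwv θ
    have h3 := hw0 θ
    simp only [L', Set.mem_Icc]
    split_ifs <;> constructor <;> linarith [h1.1, h1.2]
  have hρ' : ∀ θ, risk P L' (ρ.map fun a => e (a, false)) θ = 1 / 4 := fun θ => by
    rw [risk_map]
    simpa [L'] using hlρ θ
  have hσ₀' : ∀ θ, risk Q L' (σ₀.map fun a => e (a, true)) θ = v := fun θ => by
    rw [risk_map]
    have := risk_affine Q hQ l σ₀ 1 (fun θ => v - w θ) θ
    simp only [one_mul] at this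
    simp only [L', Equiv.symm_apply_apply, if_true, this]
    exact add_sub_cancel _ _
  -- Forgetting the flag never increases the risk, so the surcharged copies do not lower the minimax
  -- value v.
  have hlow : ∀ σ : Kernel 𝓣 (Fin (Fintype.card (Fin k × Bool))), IsMarkovKernel σ →
      v ≤ worstRisk Q L' σ := fun σ hσ => by
    have hm := Kernel.IsMarkovKernel.map σ
      (f := fun b => (e.symm b).1) Measurable.of_discrete
    refine (hmin _ hm).trans (ciSup_mono (bddAbove_range_risk hQ hL' σ) fun θ => ?_)
    rw [risk_map]
    refine risk_mono_loss Q hQ (fun θ b => ?_) σ θ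
    simp only [L']
    refine le_add_of_nonneg_right ?_
    split_ifs
    · exact sub_nonneg.2 (hwv θ)
    · exact le_rfl
  refine ⟨_, L', hL', fun σ hσ => ⟨σ ∘ₖ M, inferInstance, fun θ => (risk_comp hP M L' σ θ).le⟩,
    ρ.map fun a => e (a, false), Kernel.IsMarkovKernel.map ρ Measurable.of_discrete,
    ⟨γ / 4, by positivity, fun σ hσ => ?_⟩, σ₀.map fun a => e (a, true),
    Kernel.IsMarkovKernel.map σ₀ Measurable.of_discrete, fun σ hσ => ?_, fun θ => ?_,
    Classical.arbitrary Θ, ?_⟩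
  · have : worstRisk P L' (ρ.map fun a => e (a, false)) = 1 / 4 := by
      unfold worstRisk
      simp_rw [hρ', ciSup_const]
    rw [this]
    exact hvγ.trans (hlow σ hσ)
  · refine le_trans (le_of_eq ?_) (hlow σ hσ)
    unfold worstRisk
    simp_rw [hσ₀', ciSup_const]
  · rw [hρ', hσ₀']; linarith
  · rw [hρ', hσ₀']; linarith

/-- The deficiency gap for a garbling of a dominated experiment that is not Blackwell-sufficient. -/
theorem deficiency_gap [Nonempty Θ] [StandardBorelSpace 𝓩] {P : Θ → Measure 𝓩}
    (hP : ∀ θ, IsProbabilityMeasure (P θ)) (hdom : IsDominated P) (M : Kernel 𝓩 𝓣)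
    [IsMarkovKernel M] {Q : Θ → Measure 𝓣} (hQM : ∀ θ, Q θ = M ∘ₘ P θ)
    (hnot : ¬ BlackwellSufficient Q P) :
    0 < deficiency Q P ∧
      ∃ (k : ℕ) (L : Θ → Fin k → ℝ), IsUnitLoss L ∧ UniformlyDominatedOn Q P L := by
  have hQ : ∀ θ, IsProbabilityMeasure (Q θ) := fun θ => by rw [hQM]; infer_instance
  obtain ⟨μ, hμ, hPμ⟩ := hdom
  -- Domination passes through the garbling; a finite measure equivalent to μ is used since the
  -- compactness results need one.
  have hν : ∀ θ, Q θ ≪ M ∘ₘ μ.toFinite := fun θ => by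
    rw [hQM]
    exact ((hPμ θ).trans (absolutelyContinuous_toFinite μ)).comp_right M
  obtain ⟨k, L, hL, ρ, hρ, γ, hγ, hsep⟩ : ∃ (k : ℕ) (L : Θ → Fin k → ℝ), IsUnitLoss L ∧
      ∃ ρ : Kernel 𝓩 (Fin k), IsMarkovKernel ρ ∧ ∃ γ > 0, ∀ σ : Kernel 𝓣 (Fin k),
        IsMarkovKernel σ → ∃ θ, γ ≤ risk Q L σ θ - risk P L ρ θ := by
    by_contra! H
    exact hnot (blackwellSufficient_of_not_separated hQ hP _ hν H)
  exact ⟨hγ.trans_le (deficiency_ge_of_separated hQ hP hL ρ hsep),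
    exists_uniformlyDominatedOn hP M hQM _ hν hL ρ hγ hsep⟩

end Domination

/-! ### Statistics with auxiliary randomness as garblings, and the theorem. -/

theorem map_compProd_eq_comp {𝓩 𝓤 𝓢 : Type*} [MeasurableSpace 𝓩] [MeasurableSpace 𝓤]
    [MeasurableSpace 𝓢] (m : Measure 𝓩) [SFinite m] (κ : Kernel 𝓩 𝓤) [IsSFiniteKernel κ]
    {g : 𝓩 × 𝓤 → 𝓢} (hg : Measurable g) :
    (m ⊗ₘ κ).map g = (Kernel.id ×ₖ κ).map g ∘ₘ m := by
  rw [Measure.compProd_eq_comp_prod, Measure.map_comp _ _ hg]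

end StatExp

theorem mainTheorem6 {Θ 𝓧 𝓨 𝓤 𝓣 𝓒 : Type*} [Nonempty Θ]
    [MeasurableSpace 𝓧] [StandardBorelSpace 𝓧] [MeasurableSpace 𝓨] [StandardBorelSpace 𝓨]
    [MeasurableSpace 𝓤] [MeasurableSpace 𝓣] [MeasurableSpace 𝓒]
    (P : Θ → Measure (𝓧 × 𝓨)) (hP : ∀ θ, IsProbabilityMeasure (P θ))
    (hdom : StatExp.IsDominated P)
    (κ : Kernel (𝓧 × 𝓨) 𝓤) (hκ : IsMarkovKernel κ)
    (T : 𝓧 × 𝓤 → 𝓣) (hT : Measurable T)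
    (C : (𝓧 × 𝓨) × 𝓤 → 𝓒) (hC : Measurable C) :
    (¬ StatExp.BlackwellSufficient (StatExp.proxyExperiment P κ T) P →
      0 < StatExp.deficiency (StatExp.proxyExperiment P κ T) P ∧
      ∃ (k : ℕ) (L : Θ → Fin k → ℝ), StatExp.IsUnitLoss L ∧
        StatExp.UniformlyDominatedOn (StatExp.proxyExperiment P κ T) P L) ∧
    (¬ StatExp.BlackwellSufficient (StatExp.correctedExperiment P κ T C) P →
      0 < StatExp.deficiency (StatExp.correctedExperiment P κ T C) P ∧
      ∃ (k : ℕ) (L : Θ → Fin k → ℝ), StatExp.IsUnitLoss L ∧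
        StatExp.UniformlyDominatedOn (StatExp.correctedExperiment P κ T C) P L) := by
  have hT' : Measurable fun z : (𝓧 × 𝓨) × 𝓤 => T (z.1.1, z.2) :=
    hT.comp (measurable_fst.fst.prodMk measurable_snd)
  have hS : Measurable fun z : (𝓧 × 𝓨) × 𝓤 => (T (z.1.1, z.2), C z) := hT'.prodMk hC
  have h1 := Kernel.IsMarkovKernel.map (Kernel.id ×ₖ κ) hT'
  have h2 := Kernel.IsMarkovKernel.map (Kernel.id ×ₖ κ) hS
  exact ⟨StatExp.deficiency_gap hP hdom _ fun θ => StatExp.map_compProd_eq_comp (P θ) κ hT',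
    StatExp.deficiency_gap hP hdom _ fun θ => StatExp.map_compProd_eq_comp (P θ) κ hS⟩
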